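/- Consider, for $m>1$, the equation $$\varrho_t=(\varrho^m)_{xx}+(\varrho V+\varrho\, W*\varrho)_x ,\tag{E}$$ where $*$ is convolution in the space variable. (1) Let $\mathbb T=\mathbb R/\mathbb Z$. There are $W\in C^\infty(\mathbb T)$ and a nonnegative $\varrho\in C^\infty(\mathbb T)$, namely $\varrho(x)=\sin(2\pi x)+1$, such that $\{\varrho=0\}\neq\emptyset$ and $\varrho$ is a stationary (classical) solution of (E) on $\mathbb T$ with $m=2$ and $V\equiv0$, that is, $(\varrho^2)_{xx}+(\varrho\,W*\varrho)_x=0$ on $\mathbb T$. (2) Let $m>1$ and let $I\subseteq\mathbb R$ be open. There are a nonnegative, bounded, integrable function $\varrho_0$ on $\mathbb R$ with $\{\varrho_0>0\}=I$ and a function $V=V(x)\in C^\infty(\mathbb R)$ all of whose derivatives of order $\ge 0$ are bounded, such that (E) on $\mathbb R\times(0,\infty)$ with $W\equiv0$ and initial data $\varrho_0$ has a unique weak solution $\varrho$, this solution is continuous on $\mathbb R\times(0,\infty)$ (after modification on null sets), and its free boundary is time-independent: $$\partial\{x:\varrho(x,t)>0\}=\partial\{x:\varrho_0(x)>0\}\qquad\text{for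 all } t>0.$$ Here a nonnegative $\varrho$ is a weak solution on $(0,T)$ with initial data $\varrho_0$ if it is bounded and integrable on $\mathbb R\times(0,T)$, $\varrho\in C([0,T];L^1(\mathbb R))$, $(\varrho^m)_x\in L^2(\mathbb R\times(0,T))$ in the sense of distributions, and for all $\phi\in C_c^\infty(\mathbb R\times[0,T))$ $$\int_0^T\!\!\int_{\mathbb R}\varrho\,\phi_t\,dx\,dt=-\int_{\mathbb R}\varrho_0\,\phi(\cdot,0)\,dx+\int_0^T\!\!\int_{\mathbb R}\big((\varrho^m)_x+\varrho\,(V+W*\varrho)\big)\phi_x\,dx\,dt .$$ A weak solution on $(0,\infty)$ is one on $(0,T)$ for every $T>0$; uniqueness means that for each $T>0$ any weak solution on $(0,T)$ with initial data $\varrho_0$ agrees with $\varrho$ almost everywhere in $x$, for every $t\in[0,T]$. -/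

import Mathlib

open MeasureTheory Set Filter Topology
open scoped ContDiff Convolution

noncomputable section

/-- A function on the flat torus `ℝ / ℤ` is `C^∞` if its `1`-periodic lift to `ℝ` is `C^∞`. -/
def SmoothOnTorus (f : UnitAddCircle → ℝ) : Prop :=
  ContDiff ℝ ∞ (fun x : ℝ => f (x : UnitAddCircle))

/-- The flux `(ϱ^m)_x + ϱ V + ϱ (W * ϱ)` on the torus `ℝ / ℤ` (total length `1`), for functions
that do not depend on time, evaluated along the covering `ℝ → ℝ / ℤ`. -/
def torusFlux (m : ℝ) (V W ρ : UnitAddCircle → ℝ) (x : ℝ) : ℝ :=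
  deriv (fun y : ℝ => ρ (y : UnitAddCircle) ^ m) x
    + ρ (x : UnitAddCircle) * (V (x : UnitAddCircle)
      + (W ⋆[ContinuousLinearMap.mul ℝ ℝ, volume] ρ) (x : UnitAddCircle))

/-- `ϱ` is a (classical) stationary solution on the torus of
`ϱ_t = (ϱ^m)_xx + (ϱ V + ϱ W * ϱ)_x`: the function `ϱ^m` is differentiable, the flux is
differentiable, and the derivative of the flux vanishes at every point. -/
def IsStationaryOnTorus (m : ℝ) (V W ρ : UnitAddCircle → ℝ) : Prop :=
  Differentiable ℝ (fun y : ℝ => ρ (y : UnitAddCircle) ^ m) ∧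
    ∀ x : ℝ, HasDerivAt (torusFlux m V W ρ) 0 x

/-- Smooth functions of one real variable all of whose derivatives (of order `≥ 0`) are bounded. -/
def SmoothBounded (V : ℝ → ℝ) : Prop :=
  ContDiff ℝ ∞ V ∧ ∀ k : ℕ, ∃ C : ℝ, ∀ x : ℝ, |iteratedDeriv k V x| ≤ C

/-- Functions on space-time are written with the time variable first. The space of test functions
`C_c^∞(J × ℝ)` for a set `J` of times. With `J = (-∞, T)` one obtains, by restriction to `t ≥ 0`,
the test functions of `C_c^∞([0, T) × ℝ)`, which need not vanish at `t = 0`. -/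
def IsTestFunction (J : Set ℝ) (φ : ℝ × ℝ → ℝ) : Prop :=
  ContDiff ℝ ∞ φ ∧ HasCompactSupport φ ∧ tsupport φ ⊆ J ×ˢ univ

/-- The time derivative of a function of `(t, x)`. -/
def dt (φ : ℝ × ℝ → ℝ) (p : ℝ × ℝ) : ℝ := deriv (fun s : ℝ => φ (s, p.2)) p.1

/-- The space derivative of a function of `(t, x)`. -/
def dx (φ : ℝ × ℝ → ℝ) (p : ℝ × ℝ) : ℝ := deriv (fun y : ℝ => φ (p.1, y)) p.2

/-- The space-time strip `(0, T) × ℝ`. -/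
def strip (T : ℝ) : Set (ℝ × ℝ) := Ioo 0 T ×ˢ univ

/-- `g` is the weak (distributional) space derivative of `f` on `(0, T) × ℝ`. -/
def HasWeakSpaceDeriv (T : ℝ) (f g : ℝ → ℝ → ℝ) : Prop :=
  LocallyIntegrableOn (Function.uncurry f) (strip T) ∧
  LocallyIntegrableOn (Function.uncurry g) (strip T) ∧
  ∀ φ : ℝ × ℝ → ℝ, IsTestFunction (Ioo 0 T) φ →
    ∫ p in strip T, f p.1 p.2 * dx φ p = - ∫ p in strip T, g p.1 p.2 * φ p

/-- `ϱ ∈ C([0, T], L¹(ℝ))`. -/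
def ContinuousInL1 (T : ℝ) (ρ : ℝ → ℝ → ℝ) : Prop :=
  ∀ t ∈ Icc 0 T, MemLp (ρ t) 1 volume ∧
    Tendsto (fun s => eLpNorm (ρ s - ρ t) 1 volume) (𝓝[Icc 0 T] t) (𝓝 0)

/-- Weak solutions on `(0, T)` of `ϱ_t = (ϱ^m)_xx + (ϱ V + ϱ W * ϱ)_x` in `ℝ` with initial
data `ϱ₀`; the convolution is in the space variable. All of `ρ`, `V`, `W` are functions of
`t` and `x`, in this order; `g` is the weak derivative `(ϱ^m)_x`. -/
structure IsWeakSolution (m T : ℝ) (V W : ℝ → ℝ → ℝ) (ρ₀ : ℝ → ℝ) (ρ : ℝ → ℝ → ℝ) : Prop where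
  nonneg : ∀ t ∈ Icc 0 T, ∀ x, 0 ≤ ρ t x
  bounded : MemLp (Function.uncurry ρ) ⊤ (volume.restrict (strip T))
  integrable : IntegrableOn (Function.uncurry ρ) (strip T)
  continuous : ContinuousInL1 T ρ
  weak_eq : ∃ g : ℝ → ℝ → ℝ,
    HasWeakSpaceDeriv T (fun t x => ρ t x ^ m) g ∧
    MemLp (Function.uncurry g) 2 (volume.restrict (strip T)) ∧
    ∀ φ : ℝ × ℝ → ℝ, IsTestFunction (Iio T) φ →
      ∫ p in strip T, ρ p.1 p.2 * dt φ p =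
        - (∫ x : ℝ, ρ₀ x * φ (0, x))
        + ∫ p in strip T,
            (g p.1 p.2 + ρ p.1 p.2 *
              (V p.1 p.2 + (W p.1 ⋆[ContinuousLinearMap.mul ℝ ℝ, volume] ρ p.1) p.2)) * dx φ p

/-- The positivity set `{f > 0}` of a function on `ℝ`. -/
def positivitySet (f : ℝ → ℝ) : Set ℝ := {x | 0 < f x}

/-- The free boundary `Γ = ∂ {f > 0}`. -/
def freeBoundary (f : ℝ → ℝ) : Set ℝ := frontier (positivitySet f)

end

/-! Both parts rest on making the flux vanish identically. On the torus, convolving $W=8\pi\sin(2\pi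
x)$ with $\varrho=\sin(2\pi x)+1$ gives $-4\pi\cos(2\pi x)$, which cancels
$(\varrho^2)_x=2\varrho\varrho_x$.

On the line, take a smooth $h\ge 0$ with $\{h>0\}=I$ and set $\varrho_0=h^{\alpha}$,
$\alpha=1/(m-1)$, and $V=-(\alpha+1)h'$. As $\alpha m=\alpha+1$,
$(\varrho_0^m)_x=(\alpha+1)h^{\alpha}h'=-\varrho_0V$, so $\varrho_0$ is a stationary solution;
continuity and the fixed free boundary are then immediate. This is `exists_stationary_profile` with
`isWeakSolution_of_flux_eq_zero`.

The real work is uniqueness (`IsWeakSolution.unique`), an $H^{-1}$ energy estimate. For two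
solutions let $w=\varrho_1-\varrho_2$ and $\Phi=\varrho_1^m-\varrho_2^m$, so that $w\Phi\ge 0$ and
$w_t=F_x$ with $F=\Phi_x+Vw$ and zero initial data. The potential $v=e^{-ct}\int_0^tF$ satisfies
$v_x=e^{-ct}w$ and $cv+v_t=e^{-ct}F$. Pairing the second identity with $v$, the term in $\Phi_x$ has
a sign after integration by parts, and the drift costs at most a multiple of $\sup|V'|\,\|v\|^2$.
For $c$ large, $v=0$, hence $w=0$ (`ae_eq_zero_of_weak_equation`). Derivatives are handled as
generators of translations of $L^2(\mathbb R^2)$, so that integration by parts is skew-adjointness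
and needs no mollification. -/

noncomputable section

/-! ### Translation groups on $L^2$, their generators and resolvents. -/

section Shift

variable {E : Type*} [NormedAddCommGroup E] [MeasurableSpace E] [BorelSpace E]
  {μ : Measure E} [μ.IsAddHaarMeasure]

/-- Translation by `v` as a linear isometry of `L²`. -/
def shift (μ : Measure E) [μ.IsAddHaarMeasure] (v : E) : Lp ℝ 2 μ →ₗᵢ[ℝ] Lp ℝ 2 μ :=
  Lp.compMeasurePreservingₗᵢ ℝ (· + v) (measurePreserving_add_right μ v)

theorem coeFn_shift (v : E) (f : Lp ℝ 2 μ) : shift μ v f =ᵐ[μ] fun p => f (p + v) :=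
  Lp.coeFn_compMeasurePreserving f (measurePreserving_add_right μ v)

theorem shift_shift (v w : E) (f : Lp ℝ 2 μ) : shift μ v (shift μ w f) = shift μ (v + w) f := by
  refine Lp.ext ?_
  filter_upwards [coeFn_shift v (shift μ w f), coeFn_shift (v + w) f,
    (measurePreserving_add_right μ v).quasiMeasurePreserving.ae (coeFn_shift w f)] with p h1 h2 h3
  rw [h1, h2, h3, add_assoc]

theorem shift_zero (f : Lp ℝ 2 μ) : shift μ 0 f = f := by
  refine Lp.ext ?_
  filter_upwards [coeFn_shift 0 f] with p h1
  rw [h1, add_zero]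

theorem inner_shift_left (v : E) (f g : Lp ℝ 2 μ) :
    inner ℝ (shift μ v f) g = inner ℝ f (shift μ (-v) g) := by
  conv_lhs => rw [← shift_zero g, ← add_neg_cancel v, ← shift_shift]
  exact (shift μ v).inner_map_map _ _

variable [NormedSpace ℝ E]

/-- Differentiation along `v` is skew-adjoint. -/
theorem inner_add_inner_eq_zero_of_hasDerivAt_shift {v : E} {f g k l : Lp ℝ 2 μ}
    (hf : HasDerivAt (fun r : ℝ => shift μ (r • v) f) g 0)
    (hk : HasDerivAt (fun r : ℝ => shift μ (r • v) k) l 0) :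
    inner ℝ g k + inner ℝ f l = 0 := by
  have h := hf.inner ℝ hk
  simp only [(shift μ _).inner_map_map, zero_smul, shift_zero] at h
  rw [add_comm]
  exact h.unique (hasDerivAt_const _ _)

variable [FiniteDimensional ℝ E]

theorem continuous_shift (f : Lp ℝ 2 μ) : Continuous fun v => shift μ v f := by
  have := (continuous_const (y := f)).compMeasurePreservingLp (μ := μ) (ν := μ) (Z := E)
    (g := fun v => ⟨(· + v), by fun_prop⟩) (ContinuousMap.continuous_of_continuous_uncurry _
      (by simp only [Function.uncurry_def, ContinuousMap.coe_mk]; fun_prop))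
    (fun v => measurePreserving_add_right μ v) (by simp)
  exact this

/-- Translations are strongly continuous, so the fundamental theorem of calculus applies. The
integrated identity is the form in which a weak derivative can be tested. -/
theorem hasDerivAt_shift_of_eq_add_integral {v : E} {f g : Lp ℝ 2 μ}
    (h : ∀ r : ℝ, shift μ (r • v) f = f + ∫ s in (0 : ℝ)..r, shift μ (s • v) g) :
    HasDerivAt (fun r : ℝ => shift μ (r • v) f) g 0 := by
  have hc : Continuous fun s : ℝ => shift μ (s • v) g :=
    (continuous_shift g).comp (by fun_prop)
  have := (intervalIntegral.integral_hasDerivAt_right (hc.intervalIntegrable 0 0)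
    hc.aestronglyMeasurable.stronglyMeasurableAtFilter hc.continuousAt).const_add f
  simp only [zero_smul, shift_zero] at this
  exact this.congr_of_eventuallyEq (Eventually.of_forall h)

/-- The resolvent at `c` of differentiation along `v`, i.e. the solution `u` of
`c u + ∂_v u = f`. -/
def shiftResolvent (μ : Measure E) [μ.IsAddHaarMeasure] (v : E) (c : ℝ) (f : Lp ℝ 2 μ) :
    Lp ℝ 2 μ :=
  ∫ r in Ioi (0 : ℝ), Real.exp (-c * r) • shift μ (-r • v) f

theorem continuous_exp_smul_shift (v : E) (c : ℝ) (f : Lp ℝ 2 μ) :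
    Continuous fun r : ℝ => Real.exp (-c * r) • shift μ (-r • v) f :=
  (by fun_prop : Continuous fun r : ℝ => Real.exp (-c * r)).smul
    ((continuous_shift f).comp (by fun_prop))

theorem integrableOn_exp_smul_shift (v : E) {c : ℝ} (hc : 0 < c) (f : Lp ℝ 2 μ) (a : ℝ) :
    IntegrableOn (fun r : ℝ => Real.exp (-c * r) • shift μ (-r • v) f) (Ioi a) := by
  refine ((exp_neg_integrableOn_Ioi a hc).mul_const ‖f‖).mono'
    (continuous_exp_smul_shift v c f).aestronglyMeasurable (Eventually.of_forall fun r => ?_)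
  rw [norm_smul, LinearIsometry.norm_map, Real.norm_of_nonneg (Real.exp_pos _).le]

/-- Substituting $r\mapsto r+h$ puts all dependence on $h$ into a scalar factor and an endpoint of
integration. The resolvent is therefore differentiable along $v$ even though $f$ is only in $L^2$.
-/
theorem shift_shiftResolvent (v : E) {c : ℝ} (hc : 0 < c) (f : Lp ℝ 2 μ) (h : ℝ) :
    shift μ (h • v) (shiftResolvent μ v c f) = Real.exp (-c * h) •
      (shiftResolvent μ v c f
        - ∫ r in (0 : ℝ)..(-h), Real.exp (-c * r) • shift μ (-r • v) f) := by
  have h1 : shift μ (h • v) (shiftResolvent μ v c f)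
      = ∫ r in Ioi (0 : ℝ), shift μ (h • v) (Real.exp (-c * r) • shift μ (-r • v) f) :=
    ((shift μ (h • v)).toContinuousLinearMap.integral_comp_comm
      (integrableOn_exp_smul_shift v hc f 0)).symm
  have h2 : ∫ r in Ioi (-h), Real.exp (-c * r) • shift μ (-r • v) f
      = shiftResolvent μ v c f
        - ∫ r in (0 : ℝ)..(-h), Real.exp (-c * r) • shift μ (-r • v) f := by
    rw [eq_sub_iff_add_eq', shiftResolvent]
    exact intervalIntegral.integral_interval_add_Ioi (integrableOn_exp_smul_shift v hc f 0)
      (integrableOn_exp_smul_shift v hc f (-h))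
  rw [← h2, h1, ← integral_smul]
  have h3 := (measurePreserving_add_right volume (-h)).setIntegral_preimage_emb
    (measurableEmbedding_addRight (-h))
    (fun r : ℝ => Real.exp (-c * h) • Real.exp (-c * r) • shift μ (-r • v) f) (Ioi (-h))
  rw [← h3, preimage_add_const_Ioi, sub_self]
  refine integral_congr_ae (Eventually.of_forall fun r => ?_)
  simp only [map_smul, shift_shift, smul_smul, ← Real.exp_add, ← add_smul]
  congr 2 <;> ring_nf

theorem hasDerivAt_shift_shiftResolvent (v : E) {c : ℝ} (hc : 0 < c) (f : Lp ℝ 2 μ) :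
    HasDerivAt (fun h : ℝ => shift μ (h • v) (shiftResolvent μ v c f))
      (f - c • shiftResolvent μ v c f) 0 := by
  have hcont := continuous_exp_smul_shift v c f
  have h1 : HasDerivAt (fun h : ℝ => ∫ r in (0 : ℝ)..(-h),
      Real.exp (-c * r) • shift μ (-r • v) f) (-f) 0 := by
    have h2 := (intervalIntegral.integral_hasDerivAt_right (hcont.intervalIntegrable 0 (-0))
      hcont.aestronglyMeasurable.stronglyMeasurableAtFilter hcont.continuousAt)
    have h3 := h2.scomp (0 : ℝ) (hasDerivAt_neg (0 : ℝ))
    simpa [Function.comp_def, shift_zero] using h3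
  have h4 : HasDerivAt (fun h : ℝ => Real.exp (-c * h)) (-c) 0 := by
    simpa using ((hasDerivAt_id (0 : ℝ)).const_mul (-c)).exp
  have h5 := h4.smul (h1.const_sub (shiftResolvent μ v c f))
  have h6 : (fun h : ℝ => shift μ (h • v) (shiftResolvent μ v c f)) = fun h : ℝ =>
      Real.exp (-c * h) • (shiftResolvent μ v c f
        - ∫ r in (0 : ℝ)..(-h), Real.exp (-c * r) • shift μ (-r • v) f) :=
    funext fun h => shift_shiftResolvent v hc f h
  rw [h6]
  refine h5.congr_deriv ?_
  simp [sub_eq_add_neg]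

/-- Pair $cu+\partial_vu=f$ with $u$: the derivative term drops out by skew-adjointness. -/
theorem mul_norm_shiftResolvent_sq (v : E) {c : ℝ} (hc : 0 < c) (f : Lp ℝ 2 μ) :
    c * ‖shiftResolvent μ v c f‖ ^ 2 = inner ℝ f (shiftResolvent μ v c f) := by
  have h := hasDerivAt_shift_shiftResolvent v hc f
  have h2 := inner_add_inner_eq_zero_of_hasDerivAt_shift h h
  rw [inner_sub_left, inner_sub_right, inner_smul_left, inner_smul_right,
    real_inner_comm f, real_inner_self_eq_norm_sq] at h2
  simp only [conj_trivial] at h2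
  linarith

/-- Passing to the adjoint moves the translations onto $k$, which will be a test function. -/
theorem inner_shiftResolvent_left (v : E) {c : ℝ} (hc : 0 < c) (f k : Lp ℝ 2 μ) :
    inner ℝ (shiftResolvent μ v c f) k
      = ∫ r in Ioi (0 : ℝ), Real.exp (-c * r) * inner ℝ f (shift μ (r • v) k) := by
  rw [real_inner_comm, shiftResolvent]
  rw [← innerSL_apply_apply ℝ k, ← ContinuousLinearMap.integral_comp_comm _
    (integrableOn_exp_smul_shift v hc f 0)]
  refine integral_congr_ae (Eventually.of_forall fun r => ?_)
  simp only [innerSL_apply_apply, inner_smul_right]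
  rw [real_inner_comm, inner_shift_left]
  simp

end Shift

/-! ### Differentiating integrals against translated test functions. -/

section TestFunctions

variable {E : Type*} [NormedAddCommGroup E] [MeasurableSpace E] [BorelSpace E]
  [NormedSpace ℝ E] [FiniteDimensional ℝ E] {μ : Measure E}

/-- Translation derivative of a test function integrated against a locally integrable function. -/
theorem hasDerivAt_integral_mul_shift {f ψ : E → ℝ} (hf : LocallyIntegrable f μ)
    (hψ : ContDiff ℝ 1 ψ) (hc : HasCompactSupport ψ) (v : E) (r : ℝ) :
    HasDerivAt (fun r : ℝ => ∫ p, f p * ψ (p + r • v) ∂μ)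
      (∫ p, f p * fderiv ℝ ψ (p + r • v) v ∂μ) r := by
  have hc' : HasCompactSupport (fderiv ℝ ψ) := hc.fderiv ℝ
  have hcd : Continuous (fderiv ℝ ψ) := hψ.continuous_fderiv (by norm_num)
  obtain ⟨C, hC⟩ := hc'.exists_bound_of_continuous hcd
  -- A compact set containing the supports of all $\psi(\cdot+sv)$ with $|s-r|\le 1$; the dominating
  -- function lives on it.
  set K : Set E := (fun q : E × ℝ => q.1 - q.2 • v) '' (tsupport ψ ×ˢ Metric.closedBall r 1)
  have hK : IsCompact K :=
    (IsCompact.prod hc (isCompact_closedBall r 1)).image (by fun_prop)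
  have hKmem : ∀ s ∈ Metric.closedBall r 1, ∀ p ∉ K, p + s • v ∉ tsupport ψ := by
    intro s hs p hp hmem
    exact hp ⟨(p + s • v, s), ⟨hmem, hs⟩, by simp⟩
  have hint : ∀ s : ℝ, Integrable (fun p => f p * ψ (p + s • v)) μ := by
    intro s
    have hcs : HasCompactSupport fun p => ψ (p + s • v) :=
      hc.comp_homeomorph (Homeomorph.addRight (s • v))
    simpa [mul_comm] using hf.integrable_smul_left_of_hasCompactSupport
      (hψ.continuous.comp (by fun_prop : Continuous fun p : E => p + s • v)) hcs
  refine (hasDerivAt_integral_of_dominated_loc_of_deriv_le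
    (F' := fun s p => f p * fderiv ℝ ψ (p + s • v) v)
    (bound := K.indicator fun p => ‖f p‖ * (C * ‖v‖)) (Metric.closedBall_mem_nhds r one_pos)
    (Eventually.of_forall fun s => (hint s).aestronglyMeasurable) (hint r) ?_ ?_ ?_ ?_).2
  · exact hf.aestronglyMeasurable.mul
      (by fun_prop : Continuous fun p : E => fderiv ℝ ψ (p + r • v) v).aestronglyMeasurable
  · refine Eventually.of_forall fun p s hs => ?_
    by_cases hp : p ∈ K
    · rw [indicator_of_mem hp, norm_mul]
      gcongr
      exact (ContinuousLinearMap.le_opNorm _ _).trans (by gcongr; exact hC _)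
    · rw [indicator_of_notMem hp, fderiv_of_notMem_tsupport ℝ (hKmem s hs p hp)]
      simp
  · exact IntegrableOn.integrable_indicator
      ((hf.integrableOn_isCompact hK).norm.mul_const _) hK.measurableSet
  · refine Eventually.of_forall fun p s _ => ?_
    have h1 : HasDerivAt (fun s : ℝ => p + s • v) v s := by
      simpa using ((hasDerivAt_id s).smul_const v).const_add p
    exact (((hψ.differentiable (by norm_num) _).hasFDerivAt).comp_hasDerivAt s h1).const_mul (f p)

end TestFunctions

/-! ### Inner products and multipliers in $L^2$. -/

section L2

variable {α : Type*} [MeasurableSpace α] {μ : Measure α}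

theorem inner_eq_integral_mul (f g : Lp ℝ 2 μ) : inner ℝ f g = ∫ p, f p * g p ∂μ := by
  rw [L2.inner_def]
  exact integral_congr_ae (Eventually.of_forall fun p => mul_comm _ _)

theorem inner_toLp_eq_integral_mul (f : Lp ℝ 2 μ) {ψ : α → ℝ} (hψ : MemLp ψ 2 μ) :
    inner ℝ f (hψ.toLp ψ) = ∫ p, f p * ψ p ∂μ := by
  rw [inner_eq_integral_mul]
  refine integral_congr_ae ?_
  filter_upwards [hψ.coeFn_toLp] with p hp
  rw [hp]

theorem inner_eq_zero_of_ae {f g : Lp ℝ 2 μ} (h : ∀ᵐ p ∂μ, f p = 0 ∨ g p = 0) :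
    inner ℝ f g = 0 := by
  rw [inner_eq_integral_mul]
  refine integral_eq_zero_of_ae ?_
  filter_upwards [h] with p hp
  simpa using hp

theorem exists_lp_ae_eq_bounded_mul {b : α → ℝ} (hb : AEStronglyMeasurable b μ) {C : ℝ}
    (hC : ∀ p, |b p| ≤ C) (f : Lp ℝ 2 μ) : ∃ k : Lp ℝ 2 μ, k =ᵐ[μ] fun p => b p * f p := by
  have h : MemLp (fun p => b p * f p) 2 μ :=
    (Lp.memLp f).of_le_mul (c := C) (hb.mul (Lp.aestronglyMeasurable f))
      (Eventually.of_forall fun p => by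
        rw [norm_mul]
        exact mul_le_mul_of_nonneg_right (hC p) (norm_nonneg _))
  exact ⟨h.toLp _, h.coeFn_toLp⟩

theorem exists_lp_ae_eq_indicator {s : Set α} (hs : MeasurableSet s) (f : Lp ℝ 2 μ) :
    ∃ k : Lp ℝ 2 μ, k =ᵐ[μ] s.indicator f :=
  ⟨((Lp.memLp f).indicator hs).toLp _, ((Lp.memLp f).indicator hs).coeFn_toLp⟩

end L2

/-! ### The strip, test functions, and weak versus strong space derivatives. -/

theorem measurableSet_strip (T : ℝ) : MeasurableSet (strip T) :=
  measurableSet_Ioo.prod MeasurableSet.univ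

theorem isOpen_strip (T : ℝ) : IsOpen (strip T) := isOpen_Ioo.prod isOpen_univ

theorem dx_eq_fderiv {φ : ℝ × ℝ → ℝ} (h : Differentiable ℝ φ) (p : ℝ × ℝ) :
    dx φ p = fderiv ℝ φ p (0, 1) := by
  have h1 : HasDerivAt (fun y : ℝ => (p.1, y)) ((0 : ℝ), (1 : ℝ)) p.2 :=
    (hasDerivAt_const _ _).prodMk (hasDerivAt_id _)
  exact ((h (p.1, p.2)).hasFDerivAt.comp_hasDerivAt p.2 h1).deriv

theorem dt_eq_fderiv {φ : ℝ × ℝ → ℝ} (h : Differentiable ℝ φ) (p : ℝ × ℝ) :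
    dt φ p = fderiv ℝ φ p (1, 0) := by
  have h1 : HasDerivAt (fun s : ℝ => (s, p.2)) ((1 : ℝ), (0 : ℝ)) p.1 :=
    (hasDerivAt_id _).prodMk (hasDerivAt_const _ _)
  exact ((h (p.1, p.2)).hasFDerivAt.comp_hasDerivAt p.1 h1).deriv

namespace IsTestFunction

variable {J : Set ℝ} {φ : ℝ × ℝ → ℝ}

theorem differentiable (h : IsTestFunction J φ) : Differentiable ℝ φ :=
  h.1.differentiable (by simp)

theorem memLp (h : IsTestFunction J φ) (q : ENNReal) : MemLp φ q volume :=
  h.1.continuous.memLp_of_hasCompactSupport h.2.1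

theorem dx (h : IsTestFunction J φ) : IsTestFunction J (dx φ) := by
  have e : _root_.dx φ = fun p => fderiv ℝ φ p (0, 1) := funext (dx_eq_fderiv h.differentiable)
  rw [e]
  exact ⟨(h.1.fderiv_right (m := ∞) (by simp)).clm_apply contDiff_const,
    h.2.1.fderiv_apply ℝ _, (tsupport_fderiv_apply_subset ℝ _).trans h.2.2⟩

theorem dt (h : IsTestFunction J φ) : IsTestFunction J (dt φ) := by
  have e : _root_.dt φ = fun p => fderiv ℝ φ p (1, 0) := funext (dt_eq_fderiv h.differentiable)
  rw [e]
  exact ⟨(h.1.fderiv_right (m := ∞) (by simp)).clm_apply contDiff_const,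
    h.2.1.fderiv_apply ℝ _, (tsupport_fderiv_apply_subset ℝ _).trans h.2.2⟩

theorem mul_left {b : ℝ × ℝ → ℝ} (hb : ContDiff ℝ ∞ b) (h : IsTestFunction J φ) :
    IsTestFunction J fun p => b p * φ p :=
  ⟨hb.mul h.1, h.2.1.mul_left, (tsupport_mul_subset_right).trans h.2.2⟩

theorem comp_add (h : IsTestFunction J φ) {J' : Set ℝ} (v : ℝ × ℝ)
    (hJ : ∀ t, t + v.1 ∈ J → t ∈ J') : IsTestFunction J' fun p => φ (p + v) := by
  refine ⟨h.1.comp (contDiff_id.add contDiff_const),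
    h.2.1.comp_homeomorph (Homeomorph.addRight v), fun p hp => ?_⟩
  have h1 : p + v ∈ tsupport φ :=
    tsupport_comp_subset_preimage φ (by fun_prop : Continuous fun p : ℝ × ℝ => p + v) hp
  exact ⟨hJ _ (h.2.2 h1).1, mem_univ _⟩

end IsTestFunction

theorem dx_comp_add {φ : ℝ × ℝ → ℝ} (v p : ℝ × ℝ) :
    dx (fun p => φ (p + v)) p = dx φ (p + v) := by
  simp only [dx, Prod.fst_add, Prod.snd_add]
  exact deriv_comp_add_const (fun y => φ (p.1 + v.1, y)) v.2 p.2

theorem dt_comp_add {φ : ℝ × ℝ → ℝ} (v p : ℝ × ℝ) :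
    dt (fun p => φ (p + v)) p = dt φ (p + v) := by
  simp only [dt, Prod.fst_add, Prod.snd_add]
  exact deriv_comp_add_const (fun s => φ (s, p.2 + v.2)) v.1 p.1

theorem dx_time_mul {b : ℝ → ℝ} {φ : ℝ × ℝ → ℝ} (p : ℝ × ℝ) :
    dx (fun p => b p.1 * φ p) p = b p.1 * dx φ p := by
  simp [dx]

theorem dx_space_mul {b : ℝ → ℝ} {φ : ℝ × ℝ → ℝ} (hb : Differentiable ℝ b)
    (hφ : Differentiable ℝ φ) (p : ℝ × ℝ) :
    dx (fun p => b p.2 * φ p) p = deriv b p.2 * φ p + b p.2 * dx φ p := by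
  have : DifferentiableAt ℝ (fun y => φ (p.1, y)) p.2 :=
    (hφ.comp (by fun_prop : Differentiable ℝ fun y : ℝ => (p.1, y))) p.2
  exact deriv_fun_mul (hb p.2) this

/-- The weak space derivative of an `L²` function supported in the strip is its derivative in the
sense of `L²` translations. -/
theorem hasDerivAt_shift_of_weak_deriv {T : ℝ} {f g : Lp ℝ 2 (volume : Measure (ℝ × ℝ))}
    (hf : ∀ᵐ p, p ∉ strip T → f p = 0) (hg : ∀ᵐ p, p ∉ strip T → g p = 0)
    (h : ∀ ψ, IsTestFunction (Ioo 0 T) ψ → ∫ p, f p * dx ψ p = -∫ p, g p * ψ p) :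
    HasDerivAt (fun r : ℝ => shift volume (r • ((0 : ℝ), (1 : ℝ))) f) g 0 := by
  set e : ℝ × ℝ := (0, 1) with he
  refine hasDerivAt_shift_of_eq_add_integral fun r => ?_
  have hcg : Continuous fun s : ℝ => shift volume (s • e) g :=
    (continuous_shift g).comp (by fun_prop)
  have hinner : ∀ k : Lp ℝ 2 (volume : Measure (ℝ × ℝ)),
      inner ℝ (∫ s in (0 : ℝ)..r, shift volume (s • e) g) k
        = ∫ s in (0 : ℝ)..r, inner ℝ (shift volume (s • e) g) k := by
    intro k
    have := (innerSL ℝ k).intervalIntegral_comp_comm (hcg.intervalIntegrable 0 r) (μ := volume)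
    simp only [innerSL_apply_apply] at this
    rw [real_inner_comm, ← this]
    exact intervalIntegral.integral_congr fun s _ => real_inner_comm _ _
  -- Translations in space preserve the strip.
  have hoff : ∀ k : Lp ℝ 2 (volume : Measure (ℝ × ℝ)), (∀ᵐ p, p ∉ strip T → k p = 0) →
      ∀ s : ℝ, ∀ᵐ p, p ∉ strip T → shift volume (s • e) k p = 0 := by
    intro k hk s
    filter_upwards [coeFn_shift (s • e) k,
      (measurePreserving_add_right volume (s • e)).quasiMeasurePreserving.ae hk] with p h1 h2 h3
    rw [h1]
    refine h2 fun h4 => h3 ?_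
    simpa [strip, he] using h4
  set z := shift volume (r • e) f - (f + ∫ s in (0 : ℝ)..r, shift volume (s • e) g) with hz
  suffices hz0 : z = 0 from sub_eq_zero.1 hz0
  -- Test functions in the strip see nothing outside it, so $z$ is treated there separately: it is
  -- orthogonal to its own truncation to the complement.
  have hoffz : ∀ᵐ p, p ∉ strip T → z p = 0 := by
    obtain ⟨ζ, hζ⟩ := exists_lp_ae_eq_indicator (measurableSet_strip T).compl z
    have horth : ∀ k : Lp ℝ 2 (volume : Measure (ℝ × ℝ)), (∀ᵐ p, p ∉ strip T → k p = 0) →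
        inner ℝ k ζ = 0 := by
      intro k hk
      refine inner_eq_zero_of_ae ?_
      filter_upwards [hk, hζ] with p h1 h2
      by_cases hp : p ∈ strip T
      · right; rw [h2]; simp [hp]
      · exact Or.inl (h1 hp)
    have hzζ : inner ℝ z ζ = 0 := by
      rw [hz, inner_sub_left, inner_add_left, horth _ (hoff f hf r), horth f hf, hinner]
      simp [horth _ (hoff g hg _)]
    have hζζ : inner ℝ ζ ζ = (0 : ℝ) := by
      rw [← hzζ, inner_eq_integral_mul, inner_eq_integral_mul]
      refine integral_congr_ae ?_
      filter_upwards [hζ] with p hp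
      rw [hp]
      by_cases hp' : p ∈ strip T <;> simp [hp']
    have hζ0 : ζ = 0 := inner_self_eq_zero.1 hζζ
    filter_upwards [hζ, Lp.coeFn_zero ℝ 2 (volume : Measure (ℝ × ℝ))] with p h1 h2 h3
    rw [hζ0, h2] at h1
    simpa [h3] using h1.symm
  -- Against $\psi$, the function $s\mapsto\langle f(\cdot+se),\psi\rangle$ has derivative $\langle
  -- g(\cdot+se),\psi\rangle$, by the weak identity for the translated test function; integrate from
  -- $0$ to $r$.
  have hflux : ∀ ψ, IsTestFunction (Ioo 0 T) ψ → ∫ p, z p * ψ p = 0 := by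
    intro ψ hψ
    have hψL := hψ.memLp 2
    set ψL := hψL.toLp ψ
    have hsh : ∀ (k : Lp ℝ 2 (volume : Measure (ℝ × ℝ))) (s : ℝ),
        inner ℝ (shift volume (s • e) k) ψL = ∫ p, k p * ψ (p + s • (-e)) := by
      intro k s
      rw [inner_shift_left, inner_eq_integral_mul]
      refine integral_congr_ae ?_
      have hq := (measurePreserving_add_right volume (-(s • e))).quasiMeasurePreserving.ae
        hψL.coeFn_toLp
      filter_upwards [coeFn_shift (-(s • e)) ψL, hq] with p h1 h2
      rw [h1, h2, smul_neg]
    have hd : ∀ s : ℝ, HasDerivAt (fun s : ℝ => inner ℝ (shift volume (s • e) f) ψL)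
        (inner ℝ (shift volume (s • e) g) ψL) s := by
      intro s
      have hloc : LocallyIntegrable f volume := (Lp.memLp f).locallyIntegrable (by norm_num)
      have h1 := hasDerivAt_integral_mul_shift hloc (hψ.1.of_le (by simp)) hψ.2.1 (-e) s
      have htest : IsTestFunction (Ioo 0 T) fun p => ψ (p + s • (-e)) :=
        hψ.comp_add _ (by simp [he])
      simp only [hsh]
      refine h1.congr_deriv ?_
      rw [← neg_eq_iff_eq_neg.2 (h _ htest), ← integral_neg]
      refine integral_congr_ae (Eventually.of_forall fun p => ?_)
      simp only [dx_comp_add, map_neg, mul_neg, dx_eq_fderiv hψ.differentiable, he]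
    have hFTC := intervalIntegral.integral_eq_sub_of_hasDerivAt (a := 0) (b := r)
      (fun s _ => hd s) ((hcg.inner continuous_const).intervalIntegrable 0 r)
    rw [← inner_toLp_eq_integral_mul z hψL, hz, inner_sub_left, inner_add_left, hinner, hFTC,
      zero_smul, shift_zero]
    ring
  have hon : ∀ᵐ p, p ∈ strip T → z p = 0 :=
    (isOpen_strip T).ae_eq_zero_of_integral_contDiff_smul_eq_zero
      (((Lp.memLp z).locallyIntegrable (by norm_num)).locallyIntegrableOn _)
      fun ψ h1 h2 h3 => by
        simpa only [smul_eq_mul, mul_comm] using hflux ψ ⟨h1, h2, h3⟩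
  refine Lp.ext ?_
  filter_upwards [hon, hoffz, Lp.coeFn_zero ℝ 2 (volume : Measure (ℝ × ℝ))] with p h1 h2 h3
  rw [h3]
  by_cases hp : p ∈ strip T
  exacts [h1 hp, h2 hp]

/-! ### The $H^{-1}$ energy estimate. -/

section Energy

/-- The `L²` function on the plane that equals `e^{-ct} f` in the strip and vanishes outside. -/
theorem exists_lp_ae_eq_exp_mul_indicator {T c : ℝ} (hc : 0 ≤ c) {f : ℝ × ℝ → ℝ}
    (hf : MemLp f 2 (volume.restrict (strip T))) :
    ∃ k : Lp ℝ 2 (volume : Measure (ℝ × ℝ)),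
      k =ᵐ[volume] (strip T).indicator fun p => Real.exp (-c * p.1) * f p := by
  have h1 : MemLp (fun p : ℝ × ℝ => Real.exp (-c * p.1) * f p) 2 (volume.restrict (strip T)) := by
    refine hf.of_le_mul (c := 1) ((by fun_prop : Continuous fun p : ℝ × ℝ =>
      Real.exp (-c * p.1)).aestronglyMeasurable.mul hf.aestronglyMeasurable) ?_
    filter_upwards [ae_restrict_mem (measurableSet_strip T)] with p hp
    rw [norm_mul, Real.norm_of_nonneg (Real.exp_pos _).le]
    refine mul_le_mul_of_nonneg_right (Real.exp_le_one_iff.2 ?_) (norm_nonneg _)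
    have : 0 < p.1 := hp.1.1
    nlinarith
  have h2 := (memLp_indicator_iff_restrict (measurableSet_strip T)).2 h1
  exact ⟨h2.toLp _, h2.coeFn_toLp⟩

theorem integral_exp_indicator_mul {T c : ℝ} {f : ℝ × ℝ → ℝ}
    {k : Lp ℝ 2 (volume : Measure (ℝ × ℝ))}
    (hk : k =ᵐ[volume] (strip T).indicator fun p => Real.exp (-c * p.1) * f p)
    (ψ : ℝ × ℝ → ℝ) :
    ∫ p, k p * ψ p = ∫ p in strip T, f p * (Real.exp (-c * p.1) * ψ p) := by
  rw [← integral_indicator (measurableSet_strip T)]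
  refine integral_congr_ae ?_
  filter_upwards [hk] with p hp
  rw [hp]
  by_cases h : p ∈ strip T
  · simp only [indicator_of_mem h]; ring
  · simp [indicator_of_notMem h]

theorem ae_eq_zero_off_of_ae_eq_indicator {α : Type*} [MeasurableSpace α] {μ : Measure α}
    {s : Set α} {k f : α → ℝ} (hk : k =ᵐ[μ] s.indicator f) : ∀ᵐ p ∂μ, p ∉ s → k p = 0 := by
  filter_upwards [hk] with p hp h
  rw [hp, indicator_of_notMem h]

/-- If `w_t = F_x` weakly with zero initial data, then the space derivative of the resolvent
`∫₀ᵗ e^{-ct} F` is `e^{-ct} w`. -/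
theorem integral_shiftResolvent_mul_dx {T c : ℝ} (hc : 0 < c) {w F : ℝ × ℝ → ℝ}
    (hw : MemLp w 2 (volume.restrict (strip T)))
    (heq : ∀ φ, IsTestFunction (Iio T) φ →
      ∫ p in strip T, w p * dt φ p = ∫ p in strip T, F p * dx φ p)
    {W F' : Lp ℝ 2 (volume : Measure (ℝ × ℝ))}
    (hW : W =ᵐ[volume] (strip T).indicator fun p => Real.exp (-c * p.1) * w p)
    (hF' : F' =ᵐ[volume] (strip T).indicator fun p => Real.exp (-c * p.1) * F p)
    {ψ : ℝ × ℝ → ℝ} (hψ : IsTestFunction (Ioo 0 T) ψ) :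
    ∫ p, shiftResolvent volume ((1 : ℝ), (0 : ℝ)) c F' p * dx ψ p = -∫ p, W p * ψ p := by
  set e : ℝ × ℝ := (1, 0) with he
  set Ψ : ℝ × ℝ → ℝ := fun p => Real.exp (-c * p.1) * ψ p with hΨdef
  have hΨ : IsTestFunction (Ioo 0 T) Ψ := hψ.mul_left (by fun_prop)
  have hdψ := hψ.dx.memLp 2
  have hind : LocallyIntegrable ((strip T).indicator w) volume :=
    ((memLp_indicator_iff_restrict (measurableSet_strip T)).2 hw).locallyIntegrable (by norm_num)
  -- Test the equation with $\Psi$ moved back in time by $r$. Its support may cross $t=0$, which is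
  -- allowed because test functions on `Iio T` need not vanish there. Integrating over $r>0$
  -- rebuilds the resolvent.
  have hder : ∀ r ∈ Ici (0 : ℝ), HasDerivAt
      (fun r : ℝ => ∫ p, (strip T).indicator w p * Ψ (p + r • e))
      (Real.exp (-c * r) * inner ℝ F' (shift volume (r • e) (hdψ.toLp _))) r := by
    intro r hr
    have hr : 0 ≤ r := hr
    refine (hasDerivAt_integral_mul_shift hind (hΨ.1.of_le (by simp)) hΨ.2.1 e r).congr_deriv ?_
    have htest : IsTestFunction (Iio T) fun p => Ψ (p + r • e) := by
      refine hΨ.comp_add _ fun t ht => ?_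
      have := ht.2
      simp only [he, Prod.smul_mk, smul_eq_mul, mul_one] at this
      exact mem_Iio.2 (by linarith)
    have h1 : ∫ p, (strip T).indicator w p * fderiv ℝ Ψ (p + r • e) e
        = ∫ p in strip T, w p * dt (fun p => Ψ (p + r • e)) p := by
      rw [← integral_indicator (measurableSet_strip T)]
      refine integral_congr_ae (Eventually.of_forall fun p => ?_)
      simp only [dt_comp_add, dt_eq_fderiv hΨ.differentiable]
      by_cases h : p ∈ strip T <;> simp [h, he]
    have h2 : inner ℝ F' (shift volume (r • e) (hdψ.toLp _)) = ∫ p, F' p * dx ψ (p + r • e) := by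
      rw [inner_eq_integral_mul]
      refine integral_congr_ae ?_
      filter_upwards [coeFn_shift (r • e) (hdψ.toLp _),
        (measurePreserving_add_right volume (r • e)).quasiMeasurePreserving.ae
          hdψ.coeFn_toLp] with p h1 h2
      rw [h1, h2]
    rw [h1, heq _ htest, h2, integral_exp_indicator_mul hF', ← integral_const_mul]
    refine integral_congr_ae (Eventually.of_forall fun p => ?_)
    beta_reduce
    rw [dx_comp_add, dx_time_mul (b := fun t => Real.exp (-c * t))]
    have : Real.exp (-c * (p + r • e).1) = Real.exp (-c * r) * Real.exp (-c * p.1) := by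
      rw [← Real.exp_add]; congr 1; simp [he]; ring
    rw [this]; ring
  have hint : IntegrableOn (fun r : ℝ => Real.exp (-c * r) *
      inner ℝ F' (shift volume (r • e) (hdψ.toLp _))) (Ioi 0) := by
    have := (innerSL ℝ F').integrable_comp
      (integrableOn_exp_smul_shift (-e) hc (hdψ.toLp _) 0)
    simpa [IntegrableOn, Function.comp_def, inner_smul_right] using this
  -- Once $r\ge T$, the translated support has left the strip through $t=0$.
  have hlim : Tendsto (fun r : ℝ => ∫ p, (strip T).indicator w p * Ψ (p + r • e)) atTop (𝓝 0) := by
    refine tendsto_const_nhds.congr' ?_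
    filter_upwards [eventually_ge_atTop T] with r hr
    rw [eq_comm]
    refine integral_eq_zero_of_ae (Eventually.of_forall fun p => ?_)
    by_cases h : p ∈ strip T
    · have h3 : p + r • e ∉ tsupport Ψ := by
        intro hmem
        have h4 := (hΨ.2.2 hmem).1.2
        have h5 := h.1.1
        simp [he] at h4
        linarith
      simp [image_eq_zero_of_notMem_tsupport h3]
    · simp [h]
  have hmain := integral_Ioi_of_hasDerivAt_of_tendsto' hder hint hlim
  rw [← inner_toLp_eq_integral_mul _ hdψ, inner_shiftResolvent_left _ hc, hmain,
    integral_exp_indicator_mul hW, zero_smul, zero_sub, neg_inj,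
    ← integral_indicator (measurableSet_strip T)]
  refine integral_congr_ae (Eventually.of_forall fun p => ?_)
  by_cases h : p ∈ strip T <;> simp [h, hΨdef]

/-- Uniqueness for `w_t = (Φ_x + V w)_x` with zero initial data, where `Φ w ≥ 0`, by an energy
estimate in `H⁻¹`. -/
theorem ae_eq_zero_of_weak_equation {T : ℝ} {w Φ G : ℝ × ℝ → ℝ} {V : ℝ → ℝ}
    (hw : MemLp w 2 (volume.restrict (strip T))) (hΦ : MemLp Φ 2 (volume.restrict (strip T)))
    (hG : MemLp G 2 (volume.restrict (strip T)))
    (hsign : ∀ᵐ p ∂volume.restrict (strip T), 0 ≤ w p * Φ p)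
    (hV : ContDiff ℝ ∞ V) {A B : ℝ} (hA : ∀ x, |V x| ≤ A) (hB : ∀ x, |deriv V x| ≤ B)
    (hweak : ∀ φ, IsTestFunction (Ioo 0 T) φ →
      ∫ p in strip T, Φ p * dx φ p = -∫ p in strip T, G p * φ p)
    (heq : ∀ φ, IsTestFunction (Iio T) φ →
      ∫ p in strip T, w p * dt φ p = ∫ p in strip T, (G p + V p.2 * w p) * dx φ p) :
    ∀ᵐ p ∂volume.restrict (strip T), w p = 0 := by
  have hB0 : 0 ≤ B := (abs_nonneg _).trans (hB 0)
  -- Any $c$ exceeding the drift loss, which is at most $B\|v\|^2$, would do.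
  set c : ℝ := B + 1
  have hc : 0 < c := by positivity
  have hV' : Continuous (deriv V) := hV.continuous_deriv (by simp)
  obtain ⟨W, hW⟩ := exists_lp_ae_eq_exp_mul_indicator (c := c) hc.le hw
  obtain ⟨P, hP⟩ := exists_lp_ae_eq_exp_mul_indicator (c := c) hc.le hΦ
  obtain ⟨Q, hQ⟩ := exists_lp_ae_eq_exp_mul_indicator (c := c) hc.le hG
  have hVm : AEStronglyMeasurable (fun p : ℝ × ℝ => V p.2) volume :=
    (hV.continuous.comp continuous_snd).aestronglyMeasurable
  have hV'm : AEStronglyMeasurable (fun p : ℝ × ℝ => deriv V p.2) volume :=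
    (hV'.comp continuous_snd).aestronglyMeasurable
  obtain ⟨VW, hVW⟩ := exists_lp_ae_eq_bounded_mul hVm (fun p => hA p.2) W
  have hF : (Q + VW : Lp ℝ 2 (volume : Measure (ℝ × ℝ))) =ᵐ[volume] (strip T).indicator
      fun p => Real.exp (-c * p.1) * (G p + V p.2 * w p) := by
    filter_upwards [Lp.coeFn_add Q VW, hQ, hVW, hW] with p h1 h2 h3 h4
    rw [h1, Pi.add_apply, h2, h3, h4]
    by_cases h : p ∈ strip T
    · simp only [indicator_of_mem h]; ring
    · simp [indicator_of_notMem h]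
  set F := Q + VW
  set v := shiftResolvent volume ((1 : ℝ), (0 : ℝ)) c F with hv
  -- After time $T$ the resolvent decays exponentially but need not vanish, so $u$ is its truncation
  -- to the strip. The energy identity holds for $v$, the space derivative for $u$.
  obtain ⟨u, hu⟩ := exists_lp_ae_eq_indicator (measurableSet_strip T) v
  obtain ⟨Vu, hVu⟩ := exists_lp_ae_eq_bounded_mul hVm (fun p => hA p.2) u
  obtain ⟨V'u, hV'u⟩ := exists_lp_ae_eq_bounded_mul hV'm (fun p => hB p.2) u
  have hu0 := ae_eq_zero_off_of_ae_eq_indicator hu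
  have hW0 := ae_eq_zero_off_of_ae_eq_indicator hW
  have huW : ∀ ψ, IsTestFunction (Ioo 0 T) ψ → ∫ p, u p * dx ψ p = -∫ p, W p * ψ p := by
    intro ψ hψ
    rw [← integral_shiftResolvent_mul_dx hc hw heq hW hF hψ]
    refine integral_congr_ae ?_
    filter_upwards [hu] with p hp
    rw [hp]
    by_cases h : p ∈ strip T
    · rw [indicator_of_mem h]
    · have : dx ψ p = 0 := image_eq_zero_of_notMem_tsupport fun h2 => h (hψ.dx.2.2 h2)
      simp [this]
  have du := hasDerivAt_shift_of_weak_deriv hu0 hW0 huW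
  have dP := hasDerivAt_shift_of_weak_deriv (ae_eq_zero_off_of_ae_eq_indicator hP)
    (ae_eq_zero_off_of_ae_eq_indicator hQ) fun ψ hψ => by
      rw [integral_exp_indicator_mul hP, integral_exp_indicator_mul hQ,
        ← hweak _ (hψ.mul_left (b := fun p => Real.exp (-c * p.1)) (by fun_prop))]
      simp only [dx_time_mul (b := fun t => Real.exp (-c * t))]
  have dVu : HasDerivAt (fun r : ℝ => shift volume (r • ((0 : ℝ), (1 : ℝ))) Vu) (V'u + VW) 0 := by
    refine hasDerivAt_shift_of_weak_deriv (T := T) ?_ ?_ fun ψ hψ => ?_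
    · filter_upwards [hVu, hu0] with p h1 h2 h3
      rw [h1, h2 h3, mul_zero]
    · filter_upwards [Lp.coeFn_add V'u VW, hV'u, hVW, hu0, hW0] with p h1 h2 h3 h4 h5 h6
      rw [h1, Pi.add_apply, h2, h3, h4 h6, h5 h6]
      simp
    · have htest : IsTestFunction (Ioo 0 T) fun p => V p.2 * ψ p :=
        hψ.mul_left (b := fun p => V p.2) (hV.comp contDiff_snd)
      have hVt := huW _ htest
      have hi1 : Integrable (fun p => V'u p * ψ p) volume :=
        (Lp.memLp V'u).integrable_mul (hψ.memLp 2)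
      have hi2 : Integrable (fun p => VW p * ψ p) volume :=
        (Lp.memLp VW).integrable_mul (hψ.memLp 2)
      have hi3 : Integrable (fun p => Vu p * dx ψ p) volume :=
        (Lp.memLp Vu).integrable_mul (hψ.dx.memLp 2)
      have e1 : ∫ p, u p * dx (fun p => V p.2 * ψ p) p
          = (∫ p, V'u p * ψ p) + ∫ p, Vu p * dx ψ p := by
        rw [← integral_add hi1 hi3]
        refine integral_congr_ae ?_
        filter_upwards [hVu, hV'u] with p h1 h2
        rw [h1, h2, dx_space_mul (hV.differentiable (by simp)) hψ.differentiable]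
        ring
      have e2 : ∫ p, W p * (V p.2 * ψ p) = ∫ p, VW p * ψ p := by
        refine integral_congr_ae ?_
        filter_upwards [hVW] with p h1
        rw [h1]; ring
      have e3 : ∫ p, (V'u + VW : Lp ℝ 2 (volume : Measure (ℝ × ℝ))) p * ψ p
          = (∫ p, V'u p * ψ p) + ∫ p, VW p * ψ p := by
        rw [← integral_add hi1 hi2]
        refine integral_congr_ae ?_
        filter_upwards [Lp.coeFn_add V'u VW] with p h1
        rw [h1, Pi.add_apply, add_mul]
      rw [e1, e2] at hVt
      rw [e3]
      linarith
  -- These give $\langle Q,u\rangle=-\langle P,W\rangle$ and, with `hVuW`, $2\langle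
  -- VW,u\rangle=-\langle V'u,u\rangle$.
  have s1 := inner_add_inner_eq_zero_of_hasDerivAt_shift dP du
  have s2 := inner_add_inner_eq_zero_of_hasDerivAt_shift dVu du
  have hPW : 0 ≤ inner ℝ P W := by
    rw [inner_eq_integral_mul]
    refine integral_nonneg_of_ae ?_
    filter_upwards [hP, hW, (ae_restrict_iff' (measurableSet_strip T)).1 hsign] with p h1 h2 h3
    rw [h1, h2]
    by_cases h : p ∈ strip T
    · simp only [indicator_of_mem h, Pi.zero_apply]
      have := mul_nonneg (mul_self_nonneg (Real.exp (-c * p.1))) (h3 h)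
      linarith
    · simp [h]
  have hVuW : inner ℝ Vu W = inner ℝ VW u := by
    rw [inner_eq_integral_mul, inner_eq_integral_mul]
    refine integral_congr_ae ?_
    filter_upwards [hVu, hVW] with p h1 h2
    rw [h1, h2]; ring
  have huv : inner ℝ u v = ‖u‖ ^ 2 := by
    rw [← real_inner_self_eq_norm_sq, inner_eq_integral_mul, inner_eq_integral_mul]
    refine integral_congr_ae ?_
    filter_upwards [hu] with p hp
    by_cases h : p ∈ strip T <;> simp [hp, h]
  have huv_le : ‖u‖ ≤ ‖v‖ := by
    by_contra! h
    have := real_inner_le_norm u v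
    nlinarith [norm_nonneg v]
  have hV'uu : -inner ℝ V'u u ≤ B * ‖u‖ ^ 2 := by
    have h1 : ‖V'u‖ ≤ B * ‖u‖ := by
      refine Lp.norm_le_mul_norm_of_ae_le_mul ?_
      filter_upwards [hV'u] with p hp
      rw [hp, norm_mul]
      exact mul_le_mul_of_nonneg_right (hB p.2) (norm_nonneg _)
    have h2 := abs_real_inner_le_norm V'u u
    have h3 := neg_abs_le (inner ℝ V'u u)
    nlinarith [norm_nonneg u]
  have hFv : inner ℝ F v = inner ℝ Q u + inner ℝ VW u := by
    rw [← inner_add_left, inner_eq_integral_mul, inner_eq_integral_mul]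
    refine integral_congr_ae ?_
    filter_upwards [hF, hu] with p h1 h2
    by_cases h : p ∈ strip T
    · rw [h2, indicator_of_mem h]
    · rw [h1, indicator_of_notMem h]; simp
  have hen := mul_norm_shiftResolvent_sq ((1 : ℝ), (0 : ℝ)) hc F
  rw [← hv, hFv] at hen
  rw [inner_add_left, hVuW] at s2
  -- Altogether $c\|v\|^2\le\tfrac B2\|u\|^2\le B\|v\|^2$ with $c=B+1$.
  have hu_norm : ‖u‖ = 0 := by
    have hle : ‖u‖ ^ 2 ≤ ‖v‖ ^ 2 := by gcongr
    have h1 : c * ‖v‖ ^ 2 ≤ B * ‖v‖ ^ 2 := by nlinarith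
    have h2 : ‖v‖ ^ 2 ≤ 0 := by simp only [c] at h1; linarith
    have h3 : ‖u‖ ^ 2 = 0 := le_antisymm (hle.trans h2) (sq_nonneg _)
    exact pow_eq_zero_iff (two_ne_zero) |>.1 h3
  rw [norm_eq_zero.1 hu_norm] at du
  have hW_zero : W = 0 := du.unique (by simpa using hasDerivAt_const (0 : ℝ) (0 : Lp ℝ 2 _))
  rw [ae_restrict_iff' (measurableSet_strip T)]
  filter_upwards [hW, Lp.coeFn_zero ℝ 2 (volume : Measure (ℝ × ℝ))] with p h1 h2 h3
  rw [hW_zero, h2, indicator_of_mem h3] at h1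
  simpa [(Real.exp_pos _).ne'] using h1.symm

end Energy

/-! ### Smooth functions with prescribed open support. -/

section SmoothSupport

/-- Every open set is the support of a nonnegative smooth function with all derivatives bounded
which decays as fast as prescribed by a weight. -/
theorem IsOpen.exists_contDiff_support_eq_of_weight {E : Type*} [NormedAddCommGroup E]
    [NormedSpace ℝ E] [FiniteDimensional ℝ E] {I : Set E} (hI : IsOpen I) {w : E → ℝ}
    (hw : Continuous w) :
    ∃ h : E → ℝ, ContDiff ℝ ∞ h ∧ (∀ x, 0 ≤ h x) ∧ Function.support h = I ∧
      (∀ k : ℕ, ∃ C, ∀ x, ‖iteratedFDeriv ℝ k h x‖ ≤ C) ∧ ∃ C, ∀ x, w x * h x ≤ C := by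
  have hex : ∀ n : ℕ, ∃ f : E → ℝ, f.support = I ∩ Metric.ball 0 (n + 1) ∧ ContDiff ℝ ∞ f ∧
      range f ⊆ Icc 0 1 := fun n => (hI.inter Metric.isOpen_ball).exists_contDiff_support_eq
  choose f hfs hfc hfr using hex
  have hf0 : ∀ n x, 0 ≤ f n x := fun n x => (hfr n (mem_range_self x)).1
  have hcs : ∀ n, HasCompactSupport (f n) := fun n =>
    HasCompactSupport.intro' (isCompact_closedBall (0 : E) (n + 1)) Metric.isClosed_closedBall
      fun x hx => by
        by_contra h
        have : x ∈ I ∩ Metric.ball (0 : E) (n + 1) := hfs n ▸ h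
        exact hx (Metric.ball_subset_closedBall this.2)
  have hC : ∀ n k : ℕ, ∃ C, ∀ x, ‖iteratedFDeriv ℝ k (f n) x‖ ≤ C := fun n k =>
    ((hcs n).iteratedFDeriv k).exists_bound_of_continuous
      ((hfc n).continuous_iteratedFDeriv (by exact_mod_cast le_top))
  have hD : ∀ n : ℕ, ∃ D, ∀ x, ‖w x * f n x‖ ≤ D := fun n =>
    ((hcs n).mul_left (f := w)).exists_bound_of_continuous (hw.mul (hfc n).continuous)
  choose C hC using hC
  choose D hD using hD
  have hC0 : ∀ n k, 0 ≤ C n k := fun n k => (norm_nonneg _).trans (hC n k 0)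
  have hD0 : ∀ n, 0 ≤ D n := fun n => (norm_nonneg _).trans (hD n 0)
  -- $M_n$ dominates the weighted bound and the derivatives of $f_n$ up to order $n$ only; for order
  -- $k$ the series is thus controlled from $n\ge k$ on, which suffices for summability.
  set M : ℕ → ℝ := fun n => 1 + D n + ∑ k ∈ Finset.range (n + 1), C n k with hM
  have hS0 : ∀ n, 0 ≤ ∑ k ∈ Finset.range (n + 1), C n k := fun n =>
    Finset.sum_nonneg fun k _ => hC0 n k
  have hMpos : ∀ n, 0 < M n := fun n => by have := hD0 n; have := hS0 n; simp only [hM]; linarith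
  set δ : ℕ → ℝ := fun n => (1 / 2) ^ n / M n with hδ
  have hδpos : ∀ n, 0 < δ n := fun n => div_pos (by positivity) (hMpos n)
  have hδle : ∀ n b, b ≤ M n → δ n * b ≤ (1 / 2) ^ n := fun n b hb => by
    rw [hδ, div_mul_eq_mul_div, div_le_iff₀ (hMpos n)]
    exact mul_le_mul_of_nonneg_left hb (by positivity)
  have hgeo : Summable fun n : ℕ => (1 / 2 : ℝ) ^ n := summable_geometric_two
  have hv : ∀ k : ℕ, Summable fun n => δ n * C n k := by
    intro k
    refine hgeo.of_norm_bounded_eventually_nat ?_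
    filter_upwards [eventually_ge_atTop k] with n hn
    rw [Real.norm_of_nonneg (mul_nonneg (hδpos n).le (hC0 n k))]
    refine hδle n _ ?_
    have := Finset.single_le_sum (f := fun k => C n k) (fun k _ => hC0 n k)
      (Finset.mem_range.2 (Nat.lt_succ_of_le hn))
    have := hD0 n
    simp only [hM]
    linarith
  have hsm : ∀ n, ContDiff ℝ ∞ fun x => δ n • f n x := fun n => (hfc n).const_smul _
  have hbd : ∀ (k n : ℕ) (x : E), ‖iteratedFDeriv ℝ k (fun x => δ n • f n x) x‖ ≤ δ n * C n k := by
    intro k n x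
    rw [iteratedFDeriv_const_smul_apply' ((hfc n).of_le (by exact_mod_cast le_top)).contDiffAt,
      norm_smul, Real.norm_of_nonneg (hδpos n).le]
    exact mul_le_mul_of_nonneg_left (hC n k x) (hδpos n).le
  have hsum : ∀ x, Summable fun n => δ n • f n x := fun x => by
    refine (hv 0).of_norm_bounded fun n => ?_
    simpa using hbd 0 n x
  have hnn : ∀ n x, 0 ≤ δ n • f n x := fun n x => smul_nonneg (hδpos n).le (hf0 n x)
  refine ⟨fun x => ∑' n, δ n • f n x, contDiff_tsum (N := ⊤) hsm (fun k _ => hv k)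
    (fun k n x _ => hbd k n x), fun x => tsum_nonneg fun n => hnn n x, ?_, fun k => ?_, ?_⟩
  · ext x
    rw [Function.mem_support]
    constructor
    · intro h
      by_contra hx
      refine h ?_
      have : ∀ n, f n x = 0 := fun n => by
        by_contra h0
        have : x ∈ I ∩ Metric.ball (0 : E) (n + 1) := hfs n ▸ h0
        exact hx this.1
      simp [this]
    · intro hx
      obtain ⟨n, hn⟩ := exists_nat_gt ‖x‖
      have h1 : x ∈ Function.support (f n) := by
        rw [hfs n]
        exact ⟨hx, by simpa using hn.trans (by linarith)⟩
      have h2 : 0 < f n x := lt_of_le_of_ne (hf0 n x) (Ne.symm h1)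
      exact ((hsum x).tsum_pos (fun i => hnn i x) n (smul_pos (hδpos n) h2)).ne'
  · refine ⟨∑' n, δ n * C n k, fun x => ?_⟩
    rw [iteratedFDeriv_tsum_apply (N := ⊤) hsm (fun k _ => hv k) (fun k n x _ => hbd k n x) le_top]
    exact tsum_of_norm_bounded (hv k).hasSum fun n => hbd k n x
  · refine ⟨∑' n : ℕ, (1 / 2 : ℝ) ^ n, fun x => ?_⟩
    rw [← tsum_mul_left]
    refine ((hsum x).mul_left (w x)).tsum_le_tsum (fun n => ?_) hgeo
    have h1 : w x * f n x ≤ M n := by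
      have := (Real.le_norm_self _).trans (hD n x)
      have := hS0 n
      simp only [hM]
      linarith
    calc w x * δ n • f n x = δ n * (w x * f n x) := by rw [smul_eq_mul]; ring
      _ ≤ _ := hδle n _ h1

end SmoothSupport

/-! ### The stationary state on the torus. -/

section Torus

theorem exists_torus_lift {f : ℝ → ℝ} (hf : Function.Periodic f 1) :
    ∃ g : UnitAddCircle → ℝ, ∀ x : ℝ, g (x : UnitAddCircle) = f x :=
  ⟨hf.lift, fun x => hf.lift_coe x⟩

theorem convolution_torus {f g : UnitAddCircle → ℝ} (x : ℝ) :
    (f ⋆[ContinuousLinearMap.mul ℝ ℝ, volume] g) (x : UnitAddCircle)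
      = ∫ y in (0 : ℝ)..1, f (y : UnitAddCircle) * g ((x - y : ℝ) : UnitAddCircle) := by
  have h := UnitAddCircle.intervalIntegral_preimage 0
    (fun t : UnitAddCircle => f t * g ((x : UnitAddCircle) - t))
  rw [zero_add] at h
  simp only [convolution_def, ContinuousLinearMap.mul_apply']
  rw [← h]
  simp

theorem integral_sin_mul_sin_sub_add_one (x : ℝ) :
    ∫ y in (0 : ℝ)..1, Real.sin (2 * Real.pi * y) * (Real.sin (2 * Real.pi * (x - y)) + 1)
      = -(1 / 2) * Real.cos (2 * Real.pi * x) := by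
  have hpi := Real.pi_ne_zero
  -- Antiderivative from $\sin a\sin b=\tfrac12(\cos(a-b)-\cos(a+b))$ with $a=2\pi y$,
  -- $b=2\pi(x-y)$, where $a+b$ does not depend on $y$.
  have hd : ∀ y : ℝ, HasDerivAt (fun y : ℝ => -(Real.cos (2 * Real.pi * x) / 2) * y
      - Real.sin (2 * Real.pi * (2 * y - x)) / (-(8 * Real.pi))
      - Real.cos (2 * Real.pi * y) / (2 * Real.pi))
      (Real.sin (2 * Real.pi * y) * (Real.sin (2 * Real.pi * (x - y)) + 1)) y := by
    intro y
    have h1 : HasDerivAt (fun y : ℝ => 2 * Real.pi * (2 * y - x)) (2 * Real.pi * (2 * 1)) y :=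
      (((hasDerivAt_id y).const_mul 2).sub_const x).const_mul _
    have h2 : HasDerivAt (fun y : ℝ => 2 * Real.pi * y) (2 * Real.pi * 1) y :=
      (hasDerivAt_id y).const_mul _
    refine ((((hasDerivAt_id y).const_mul _).sub (h1.sin.div_const _)).sub
      (h2.cos.div_const _)).congr_deriv ?_
    have e1 : 2 * Real.pi * x = 2 * Real.pi * y + 2 * Real.pi * (x - y) := by ring
    have e2 : 2 * Real.pi * (2 * y - x) = 2 * Real.pi * y - 2 * Real.pi * (x - y) := by ring
    rw [e2, Real.cos_sub]
    conv_lhs => rw [e1, Real.cos_add]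
    field_simp
    ring
  rw [intervalIntegral.integral_eq_sub_of_hasDerivAt (fun y _ => hd y)
    (Continuous.intervalIntegrable (by fun_prop) _ _)]
  have e3 : Real.sin (2 * Real.pi * (2 * 1 - x)) = Real.sin (2 * Real.pi * (2 * 0 - x)) := by
    rw [← Real.sin_add_nat_mul_two_pi (2 * Real.pi * (2 * 0 - x)) 2]
    congr 1; push_cast; ring
  rw [e3]
  simp
  ring

/-- The constant $8\pi$ in $W$ is chosen so that $W*\varrho=-4\pi\cos(2\pi x)=-2\varrho_x$, which
makes the flux itself zero. -/
theorem exists_stationary_on_torus :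
    ∃ W ρ : UnitAddCircle → ℝ, SmoothOnTorus W ∧ SmoothOnTorus ρ ∧
      (∀ x : ℝ, ρ (x : UnitAddCircle) = Real.sin (2 * Real.pi * x) + 1) ∧
      (∀ x, 0 ≤ ρ x) ∧ {x | ρ x = 0}.Nonempty ∧
      IsStationaryOnTorus 2 (fun _ => 0) W ρ := by
  have hper : Function.Periodic (fun x : ℝ => Real.sin (2 * Real.pi * x)) 1 := fun x => by
    simp only [mul_add, mul_one, Real.sin_add_two_pi]
  obtain ⟨W, hW⟩ := exists_torus_lift (f := fun x => 8 * Real.pi * Real.sin (2 * Real.pi * x))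
    fun x => congrArg (8 * Real.pi * ·) (hper x)
  obtain ⟨ρ, hρ⟩ := exists_torus_lift (f := fun x => Real.sin (2 * Real.pi * x) + 1)
    fun x => congrArg (· + 1) (hper x)
  have hρ' : ∀ x : ℝ, HasDerivAt (fun y : ℝ => ρ (y : UnitAddCircle) ^ (2 : ℝ))
      (2 * (Real.sin (2 * Real.pi * x) + 1) * (Real.cos (2 * Real.pi * x) * (2 * Real.pi))) x := by
    intro x
    simp only [hρ, Real.rpow_two]
    have h2 : HasDerivAt (fun y : ℝ => 2 * Real.pi * y) (2 * Real.pi * 1) x :=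
      (hasDerivAt_id x).const_mul _
    simpa using (h2.sin.add_const (1 : ℝ)).fun_pow 2
  refine ⟨W, ρ, ?_, ?_, hρ, fun x => ?_, ⟨((3 / 4 : ℝ) : UnitAddCircle), ?_⟩,
    fun x => (hρ' x).differentiableAt, fun x => ?_⟩
  · simp only [SmoothOnTorus, hW]; fun_prop
  · simp only [SmoothOnTorus, hρ]; fun_prop
  · induction x using QuotientAddGroup.induction_on with
    | H y => exact (hρ y).symm ▸ by linarith [Real.neg_one_le_sin (2 * Real.pi * y)]
  · rw [mem_ofPred_eq, hρ]
    have : 2 * Real.pi * (3 / 4) = Real.pi / 2 + Real.pi := by ring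
    rw [this, Real.sin_add_pi, Real.sin_pi_div_two]
    norm_num
  · have : torusFlux 2 (fun _ => 0) W ρ = fun _ => 0 := by
      funext y
      rw [torusFlux, (hρ' y).deriv]
      simp only [convolution_torus, hW, hρ, mul_assoc (8 * Real.pi),
        intervalIntegral.integral_const_mul, integral_sin_mul_sin_sub_add_one]
      ring
    rw [this]
    exact hasDerivAt_const x 0

end Torus

/-! ### Uniqueness of weak solutions. -/

section Uniqueness

theorem ae_restrict_strip {T : ℝ} {P : ℝ × ℝ → Prop}
    (h : ∀ᵐ p ∂volume.restrict (strip T), P p) :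
    ∀ᵐ t ∂volume.restrict (Ioo 0 T), ∀ᵐ x : ℝ, P (t, x) := by
  have e : (volume : Measure (ℝ × ℝ)).restrict (strip T)
      = (volume.restrict (Ioo 0 T)).prod (volume : Measure ℝ) := by
    rw [strip, Measure.volume_eq_prod, ← Measure.prod_restrict, Measure.restrict_univ]
  rw [e] at h
  exact Measure.ae_ae_of_ae_prod h

/-- Curves continuous in `L¹` that agree at almost every time agree at every time. -/
theorem ContinuousInL1.ae_eq {T : ℝ} (hT : 0 < T) {ρ₁ ρ₂ : ℝ → ℝ → ℝ}
    (h₁ : ContinuousInL1 T ρ₁) (h₂ : ContinuousInL1 T ρ₂)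
    (h : ∀ᵐ t ∂volume.restrict (Ioo 0 T), ρ₁ t =ᵐ[volume] ρ₂ t) :
    ∀ t ∈ Icc 0 T, ρ₁ t =ᵐ[volume] ρ₂ t := by
  intro t ht
  have hm : AEStronglyMeasurable (ρ₁ t - ρ₂ t) volume :=
    (h₁ t ht).1.aestronglyMeasurable.sub (h₂ t ht).1.aestronglyMeasurable
  -- A set of full measure in $(0,T)$ accumulates at every point of $[0,T]$, endpoints included.
  have hfreq : ∃ᶠ s in 𝓝[Icc 0 T] t, s ∈ Icc 0 T ∧ ρ₁ s =ᵐ[volume] ρ₂ s := by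
    intro hev
    obtain ⟨U, hU, htU, hUs⟩ := mem_nhdsWithin.1 hev
    have hne : (U ∩ Ioo 0 T).Nonempty := by
      rw [← closure_Ioo hT.ne] at ht
      exact mem_closure_iff.1 ht U hU htU
    refine ((hU.inter isOpen_Ioo).measure_pos volume hne).ne' ?_
    rw [ae_restrict_iff' measurableSet_Ioo] at h
    refine measure_mono_null ?_ (ae_iff.1 h)
    intro s hs hcontra
    have hsI := Ioo_subset_Icc_self hs.2
    exact hUs ⟨hs.1, hsI⟩ ⟨hsI, hcontra hs.2⟩
  have hlim : Tendsto (fun s => eLpNorm (ρ₁ s - ρ₁ t) 1 volume + eLpNorm (ρ₂ s - ρ₂ t) 1 volume)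
      (𝓝[Icc 0 T] t) (𝓝 0) := by
    simpa using (h₁ t ht).2.add (h₂ t ht).2
  have hz : eLpNorm (ρ₁ t - ρ₂ t) 1 volume = 0 := by
    refine le_antisymm (ge_of_tendsto_of_frequently hlim (hfreq.mono fun s hs => ?_)) zero_le
    have hm1 := (h₁ s hs.1).1.aestronglyMeasurable.sub (h₁ t ht).1.aestronglyMeasurable
    have hm2 := (h₂ s hs.1).1.aestronglyMeasurable.sub (h₂ t ht).1.aestronglyMeasurable
    have e : ρ₁ t - ρ₂ t =ᵐ[volume] (ρ₂ s - ρ₂ t) - (ρ₁ s - ρ₁ t) := by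
      filter_upwards [hs.2] with x hx
      simp [hx]
    rw [eLpNorm_congr_ae e, add_comm]
    exact eLpNorm_sub_le hm2 hm1 le_rfl
  rw [eLpNorm_eq_zero_iff hm one_ne_zero] at hz
  filter_upwards [hz] with x hx
  exact sub_eq_zero.1 hx

namespace IsWeakSolution

variable {m T : ℝ} {V W : ℝ → ℝ → ℝ} {ρ₀ : ℝ → ℝ} {ρ : ℝ → ℝ → ℝ}

theorem ae_nonneg (h : IsWeakSolution m T V W ρ₀ ρ) :
    ∀ᵐ p ∂volume.restrict (strip T), 0 ≤ ρ p.1 p.2 := by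
  filter_upwards [ae_restrict_mem (measurableSet_strip T)] with p hp
  exact h.nonneg _ (Ioo_subset_Icc_self hp.1) _

theorem exists_ae_le (h : IsWeakSolution m T V W ρ₀ ρ) :
    ∃ M : ℝ, ∀ᵐ p ∂volume.restrict (strip T), ρ p.1 p.2 ≤ M := by
  refine ⟨(eLpNormEssSup (Function.uncurry ρ) (volume.restrict (strip T))).toReal, ?_⟩
  have hfin : eLpNormEssSup (Function.uncurry ρ) (volume.restrict (strip T)) ≠ ⊤ := by
    simpa using h.bounded.eLpNorm_ne_top
  filter_upwards [enorm_ae_le_eLpNormEssSup (Function.uncurry ρ) (volume.restrict (strip T))]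
    with p hp
  have := ENNReal.toReal_mono hfin hp
  rw [toReal_enorm] at this
  exact (Real.le_norm_self _).trans this

theorem memLp_two (h : IsWeakSolution m T V W ρ₀ ρ) :
    MemLp (fun p : ℝ × ℝ => ρ p.1 p.2) 2 (volume.restrict (strip T)) := by
  obtain ⟨M, hM⟩ := h.exists_ae_le
  refine (memLp_two_iff_integrable_sq h.integrable.aestronglyMeasurable).2 ?_
  refine (h.integrable.const_mul M).mono' (h.integrable.aestronglyMeasurable.pow 2) ?_
  filter_upwards [hM, h.ae_nonneg] with p h1 h2
  rw [Real.norm_of_nonneg (sq_nonneg _), sq]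
  exact mul_le_mul_of_nonneg_right h1 h2

theorem memLp_two_rpow (hm : 1 < m) (h : IsWeakSolution m T V W ρ₀ ρ) :
    MemLp (fun p : ℝ × ℝ => ρ p.1 p.2 ^ m) 2 (volume.restrict (strip T)) := by
  obtain ⟨M, hM⟩ := h.exists_ae_le
  refine h.memLp_two.of_le_mul (c := M ^ (m - 1))
    ((h.integrable.aestronglyMeasurable.aemeasurable.pow_const m).aestronglyMeasurable) ?_
  filter_upwards [hM, h.ae_nonneg] with p h1 h2
  rw [Real.norm_of_nonneg (Real.rpow_nonneg h2 _), Real.norm_of_nonneg h2]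
  calc ρ p.1 p.2 ^ m = ρ p.1 p.2 ^ (m - 1) * ρ p.1 p.2 := by
        rw [← Real.rpow_add_one' h2 (by linarith), sub_add_cancel]
    _ ≤ _ := mul_le_mul_of_nonneg_right (Real.rpow_le_rpow h2 h1 (by linarith)) h2

end IsWeakSolution

theorem IsTestFunction.integrableOn_mul {J : Set ℝ} {φ : ℝ × ℝ → ℝ}
    (hφ : IsTestFunction J φ) {S : Set (ℝ × ℝ)} {f : ℝ × ℝ → ℝ}
    (hf : MemLp f 2 (volume.restrict S)) : IntegrableOn (fun p => f p * φ p) S :=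
  hf.integrable_mul ((hφ.memLp 2).restrict S)

/-- Weak solutions of the porous medium equation with a smooth drift are unique. -/
theorem IsWeakSolution.unique {m T : ℝ} (hm : 1 < m) (hT : 0 < T) {V : ℝ → ℝ} {ρ₀ : ℝ → ℝ}
    (hV : ContDiff ℝ ∞ V) {A B : ℝ} (hA : ∀ x, |V x| ≤ A) (hB : ∀ x, |deriv V x| ≤ B)
    {ρ₁ ρ₂ : ℝ → ℝ → ℝ}
    (h₁ : IsWeakSolution m T (fun _ x => V x) (fun _ _ => 0) ρ₀ ρ₁)
    (h₂ : IsWeakSolution m T (fun _ x => V x) (fun _ _ => 0) ρ₀ ρ₂) :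
    ∀ t ∈ Icc 0 T, ρ₁ t =ᵐ[volume] ρ₂ t := by
  obtain ⟨g₁, hg₁, hL₁, he₁⟩ := h₁.weak_eq
  obtain ⟨g₂, hg₂, hL₂, he₂⟩ := h₂.weak_eq
  have hconv : ∀ (f : ℝ → ℝ) (x : ℝ),
      ((fun _ => (0 : ℝ)) ⋆[ContinuousLinearMap.mul ℝ ℝ, volume] f) x = 0 := fun f x =>
    congrFun (zero_convolution (g := f) (L := ContinuousLinearMap.mul ℝ ℝ) (μ := volume)) x
  simp only [hconv, add_zero] at he₁ he₂
  have hw := h₁.memLp_two.sub h₂.memLp_two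
  have hΦ := (h₁.memLp_two_rpow hm).sub (h₂.memLp_two_rpow hm)
  have hV2 : ∀ {f : ℝ × ℝ → ℝ}, MemLp f 2 (volume.restrict (strip T)) →
      MemLp (fun p => f p * V p.2) 2 (volume.restrict (strip T)) := by
    intro f hf
    refine hf.of_le_mul (c := A) (hf.aestronglyMeasurable.mul
      (hV.continuous.comp continuous_snd).aestronglyMeasurable)
      (Eventually.of_forall fun p => ?_)
    rw [norm_mul, mul_comm]
    exact mul_le_mul_of_nonneg_right (hA p.2) (norm_nonneg _)
  have hmain := ae_eq_zero_of_weak_equation hw hΦ (hL₁.sub hL₂) ?_ hV hA hB ?_ ?_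
  · refine h₁.continuous.ae_eq hT h₂.continuous ?_
    filter_upwards [ae_restrict_strip hmain] with t ht
    filter_upwards [ht] with x hx
    exact sub_eq_zero.1 hx
  · filter_upwards [h₁.ae_nonneg, h₂.ae_nonneg] with p n1 n2
    simp only [Pi.sub_apply]
    rcases le_total (ρ₁ p.1 p.2) (ρ₂ p.1 p.2) with h | h
    · exact mul_nonneg_of_nonpos_of_nonpos (sub_nonpos.2 h)
        (sub_nonpos.2 (Real.rpow_le_rpow n1 h (by linarith)))
    · exact mul_nonneg (sub_nonneg.2 h) (sub_nonneg.2 (Real.rpow_le_rpow n2 h (by linarith)))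
  · intro φ hφ
    simp only [Pi.sub_apply, sub_mul]
    rw [integral_sub (hφ.dx.integrableOn_mul (h₁.memLp_two_rpow hm))
      (hφ.dx.integrableOn_mul (h₂.memLp_two_rpow hm)),
      integral_sub (hφ.integrableOn_mul hL₁) (hφ.integrableOn_mul hL₂), hg₁.2.2 φ hφ,
      hg₂.2.2 φ hφ]
    simp only [Function.uncurry]
    ring
  · intro φ hφ
    have e : ∀ p : ℝ × ℝ, ((Function.uncurry g₁ - Function.uncurry g₂) p
        + V p.2 * ((fun p : ℝ × ℝ => ρ₁ p.1 p.2) - fun p : ℝ × ℝ => ρ₂ p.1 p.2) p) * dx φ p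
        = (g₁ p.1 p.2 + ρ₁ p.1 p.2 * V p.2) * dx φ p
          - (g₂ p.1 p.2 + ρ₂ p.1 p.2 * V p.2) * dx φ p := by
      intro p
      simp only [Pi.sub_apply, Function.uncurry]
      ring
    rw [integral_congr_ae (Eventually.of_forall e)]
    simp only [Pi.sub_apply, sub_mul]
    rw [integral_sub (hφ.dt.integrableOn_mul h₁.memLp_two)
      (hφ.dt.integrableOn_mul h₂.memLp_two),
      integral_sub (f := fun p : ℝ × ℝ => (g₁ p.1 p.2 + ρ₁ p.1 p.2 * V p.2) * dx φ p)
        (g := fun p : ℝ × ℝ => (g₂ p.1 p.2 + ρ₂ p.1 p.2 * V p.2) * dx φ p)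
        (hφ.dx.integrableOn_mul (hL₁.add (hV2 h₁.memLp_two)))
        (hφ.dx.integrableOn_mul (hL₂.add (hV2 h₂.memLp_two))), he₁ φ hφ, he₂ φ hφ]
    ring

end Uniqueness

/-! ### Zero-flux profiles on the line as weak solutions. -/

section Stationary

theorem setIntegral_strip_mul_dt {T : ℝ} (hT : 0 < T) {f : ℝ → ℝ} (hf : Continuous f)
    {φ : ℝ × ℝ → ℝ} (hφ : IsTestFunction (Iio T) φ) :
    ∫ p in strip T, f p.2 * dt φ p = -∫ x, f x * φ (0, x) := by
  have hint : Integrable (fun p : ℝ × ℝ => f p.2 * dt φ p) :=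
    ((hf.comp continuous_snd).mul hφ.dt.1.continuous).integrable_of_hasCompactSupport
      hφ.dt.2.1.mul_left
  rw [strip, Measure.volume_eq_prod, ← Measure.prod_restrict, integral_prod_symm, ← integral_neg,
    Measure.restrict_univ]
  · refine integral_congr_ae (Eventually.of_forall fun x => ?_)
    simp only
    rw [integral_const_mul, ← integral_Ioc_eq_integral_Ioo, ← intervalIntegral.integral_of_le hT.le]
    have hd : ∀ t : ℝ, HasDerivAt (fun s : ℝ => φ (s, x)) (dt φ (t, x)) t := fun t =>
      ((hφ.differentiable.comp (by fun_prop : Differentiable ℝ fun s : ℝ => (s, x))) t).hasDerivAt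
    rw [intervalIntegral.integral_eq_sub_of_hasDerivAt (fun t _ => hd t)
      (Continuous.intervalIntegrable (hφ.dt.1.continuous.comp (by fun_prop)) _ _)]
    -- Only the boundary term at $t=0$ survives; it is the initial-data term of the weak
    -- formulation.
    have : φ (T, x) = 0 := image_eq_zero_of_notMem_tsupport fun h => lt_irrefl T (hφ.2.2 h).1
    rw [this]; ring
  · rw [Measure.prod_restrict]
    exact hint.integrableOn

theorem setIntegral_strip_mul_dx {T : ℝ} {f f' : ℝ → ℝ} (hf : ∀ x, HasDerivAt f (f' x) x)
    (hf' : Continuous f') {φ : ℝ × ℝ → ℝ} (hφ : IsTestFunction (Ioo 0 T) φ) :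
    ∫ p in strip T, f p.2 * dx φ p = -∫ p in strip T, f' p.2 * φ p := by
  have hcf : Continuous f := continuous_iff_continuousAt.2 fun x => (hf x).continuousAt
  have hcs : ∀ {k : ℝ → ℝ} {ψ : ℝ × ℝ → ℝ}, Continuous k → IsTestFunction (Ioo 0 T) ψ →
      Integrable fun p : ℝ × ℝ => k p.2 * ψ p := fun hk hψ =>
    ((hk.comp continuous_snd).mul hψ.1.continuous).integrable_of_hasCompactSupport
      hψ.2.1.mul_left
  have hz : ∀ {k : ℝ → ℝ} {ψ : ℝ × ℝ → ℝ}, IsTestFunction (Ioo 0 T) ψ → ∀ p, p ∉ strip T →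
      k p.2 * ψ p = 0 := fun hψ p hp => by
    rw [image_eq_zero_of_notMem_tsupport fun h => hp (hψ.2.2 h), mul_zero]
  rw [setIntegral_eq_integral_of_forall_compl_eq_zero (hz hφ.dx),
    setIntegral_eq_integral_of_forall_compl_eq_zero (hz hφ)]
  have h1 : ∀ p : ℝ × ℝ, fderiv ℝ (fun p : ℝ × ℝ => f p.2) p (0, 1) = f' p.2 := fun p => by
    have : HasFDerivAt (fun p : ℝ × ℝ => f p.2) _ p :=
      (hf p.2).hasFDerivAt.comp p hasFDerivAt_snd
    rw [this.fderiv]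
    simp
  have h2 := integral_mul_fderiv_eq_neg_fderiv_mul_of_integrable (μ := volume) (𝕜 := ℝ)
    (f := fun p : ℝ × ℝ => f p.2) (g := φ) (v := ((0 : ℝ), (1 : ℝ)))
    (by simpa only [h1] using hcs hf' hφ)
    (by simpa only [dx_eq_fderiv hφ.differentiable] using hcs hcf hφ.dx) (hcs hcf hφ)
    (fun p _ => ((hf p.2).differentiableAt.comp p differentiableAt_snd))
    (fun p _ => hφ.differentiable p)
  simpa only [h1, dx_eq_fderiv hφ.differentiable] using h2

theorem memLp_strip_of_space {T : ℝ} {q : ENNReal} {f : ℝ → ℝ} (hf : MemLp f q volume) :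
    MemLp (fun p : ℝ × ℝ => f p.2) q (volume.restrict (strip T)) := by
  rw [strip, Measure.volume_eq_prod, ← Measure.prod_restrict, Measure.restrict_univ]
  exact hf.comp_snd _

/-- A profile whose flux `(ϱ^m)_x + ϱ V` vanishes is a time-independent weak solution. -/
theorem isWeakSolution_of_flux_eq_zero {m T : ℝ} (hm : 0 < m) (hT : 0 < T) {ρ₀ V : ℝ → ℝ}
    (hc : Continuous ρ₀) (h0 : ∀ x, 0 ≤ ρ₀ x) {C : ℝ} (hC : ∀ x, ρ₀ x ≤ C)
    (hi : Integrable ρ₀) (hV : Continuous V) {A : ℝ} (hA : ∀ x, |V x| ≤ A)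
    (hflux : ∀ x, HasDerivAt (fun y => ρ₀ y ^ m) (-(ρ₀ x * V x)) x) :
    IsWeakSolution m T (fun _ x => V x) (fun _ _ => 0) ρ₀ (fun _ => ρ₀) := by
  have hcm : Continuous fun x => ρ₀ x ^ m := hc.rpow_const fun x => Or.inr hm.le
  have h2 : MemLp ρ₀ 2 volume := by
    rw [memLp_two_iff_integrable_sq hi.aestronglyMeasurable]
    refine (hi.const_mul C).mono' (hi.aestronglyMeasurable.pow 2) (Eventually.of_forall fun x => ?_)
    rw [Real.norm_of_nonneg (sq_nonneg _), sq]
    exact mul_le_mul_of_nonneg_right (hC x) (h0 x)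
  have hg2 : MemLp (fun x => -(ρ₀ x * V x)) 2 volume := by
    refine h2.of_le_mul (c := A) (hc.mul hV).neg.aestronglyMeasurable
      (Eventually.of_forall fun x => ?_)
    rw [norm_neg, norm_mul, mul_comm]
    exact mul_le_mul_of_nonneg_right (hA x) (norm_nonneg _)
  refine ⟨fun _ _ x => h0 x, memLp_strip_of_space ?_, memLp_one_iff_integrable.1
    (memLp_strip_of_space (memLp_one_iff_integrable.2 hi)), fun t _ =>
    ⟨memLp_one_iff_integrable.2 hi, by simpa using tendsto_const_nhds⟩, fun _ x => -(ρ₀ x * V x), ⟨?_, ?_, fun φ hφ =>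
    setIntegral_strip_mul_dx hflux (hc.mul hV).neg hφ⟩, memLp_strip_of_space hg2, fun φ hφ => ?_⟩
  · refine memLp_top_of_bound hi.aestronglyMeasurable C (Eventually.of_forall fun x => ?_)
    rw [Real.norm_of_nonneg (h0 x)]
    exact hC x
  · exact ((hcm.comp continuous_snd).locallyIntegrable).locallyIntegrableOn _
  · exact (((hc.mul hV).neg.comp continuous_snd).locallyIntegrable).locallyIntegrableOn _
  · have hconv : ∀ x : ℝ,
        ((fun _ => (0 : ℝ)) ⋆[ContinuousLinearMap.mul ℝ ℝ, volume] ρ₀) x = 0 := fun x =>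
      congrFun (zero_convolution (g := ρ₀) (L := ContinuousLinearMap.mul ℝ ℝ) (μ := volume)) x
    simp only [hconv, add_zero, neg_add_cancel, zero_mul, integral_zero]
    exact setIntegral_strip_mul_dt hT hc hφ

/-- On $I$, zero flux means $\frac{m}{m-1}(\varrho_0^{m-1})_x=-V$. Choosing $h=\varrho_0^{m-1}$
smooth, rather than $\varrho_0$, makes $V$ smooth across the free boundary. -/
theorem exists_stationary_profile {m : ℝ} (hm : 1 < m) {I : Set ℝ} (hI : IsOpen I) :
    ∃ ρ₀ V : ℝ → ℝ, Continuous ρ₀ ∧ (∀ x, 0 ≤ ρ₀ x) ∧ (∃ C, ∀ x, ρ₀ x ≤ C) ∧ Integrable ρ₀ ∧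
      positivitySet ρ₀ = I ∧ SmoothBounded V ∧
      ∀ x, HasDerivAt (fun y => ρ₀ y ^ m) (-(ρ₀ x * V x)) x := by
  have hm1 : 0 < m - 1 := sub_pos.2 hm
  -- The weight yields $(1+x^2)\,h^{\alpha}\le C^{\alpha}$, hence integrability of $\varrho_0$.
  obtain ⟨h, hs, h0, hsupp, hbd, C, hC⟩ := hI.exists_contDiff_support_eq_of_weight
    (w := fun x : ℝ => (1 + x ^ 2) ^ (m - 1))
    ((by fun_prop : Continuous fun x : ℝ => 1 + x ^ 2).rpow_const fun x => Or.inr hm1.le)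
  set α : ℝ := 1 / (m - 1) with hα
  have hα0 : 0 < α := by positivity
  have hαm : α * m = α + 1 := by rw [hα]; field_simp; ring
  have hiter : ∀ k x, |iteratedDeriv k h x| = ‖iteratedFDeriv ℝ k h x‖ := fun k x => by
    rw [norm_iteratedFDeriv_eq_norm_iteratedDeriv, Real.norm_eq_abs]
  have hc : Continuous fun x => h x ^ α := hs.continuous.rpow_const fun x => Or.inr hα0.le
  have hC0 : 0 ≤ C := le_trans (by have := h0 0; positivity) (hC 0)
  refine ⟨fun x => h x ^ α, fun x => -((α + 1) * deriv h x), hc, fun x => Real.rpow_nonneg (h0 x) _,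
    ?_, ?_, ?_, ⟨?_, fun k => ?_⟩, fun x => ?_⟩
  · obtain ⟨D, hD⟩ := hbd 0
    refine ⟨D ^ α, fun x => Real.rpow_le_rpow (h0 x) ?_ hα0.le⟩
    have := hD x
    rw [norm_iteratedFDeriv_zero] at this
    exact (Real.le_norm_self _).trans this
  · refine (integrable_inv_one_add_sq.const_mul (C ^ α)).mono' hc.aestronglyMeasurable
      (Eventually.of_forall fun x => ?_)
    have hx : 0 < 1 + x ^ 2 := by positivity
    rw [Real.norm_of_nonneg (Real.rpow_nonneg (h0 x) _), ← div_eq_mul_inv, le_div_iff₀ hx]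
    have e : (1 + x ^ 2 : ℝ) = ((1 + x ^ 2) ^ (m - 1)) ^ α := by
      rw [← Real.rpow_mul hx.le, hα, mul_one_div_cancel hm1.ne', Real.rpow_one]
    rw [e, ← Real.mul_rpow (h0 x) (Real.rpow_nonneg hx.le _), mul_comm (h x)]
    exact Real.rpow_le_rpow (mul_nonneg (Real.rpow_nonneg hx.le _) (h0 x)) (hC x) hα0.le
  · rw [← hsupp]
    ext x
    change 0 < h x ^ α ↔ h x ≠ 0
    refine ⟨fun hx hz => ?_, fun hx => Real.rpow_pos_of_pos (lt_of_le_of_ne (h0 x) hx.symm) _⟩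
    rw [hz, Real.zero_rpow hα0.ne'] at hx
    exact lt_irrefl _ hx
  · exact (contDiff_const.mul (hs.iterate_deriv 1)).neg
  · obtain ⟨D, hD⟩ := hbd (k + 1)
    refine ⟨(α + 1) * D, fun x => ?_⟩
    have e : iteratedDeriv k (fun x => -((α + 1) * deriv h x)) x
        = -((α + 1) * iteratedDeriv (k + 1) h x) := by
      rw [iteratedDeriv_succ', iteratedDeriv_fun_neg, iteratedDeriv_const_mul_field]
    rw [e, abs_neg, abs_mul, abs_of_pos (by positivity : 0 < α + 1), hiter]
    exact mul_le_mul_of_nonneg_left (hD x) (by positivity)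
  · have e : (fun y => (h y ^ α) ^ m) = fun y => h y ^ (α + 1) := by
      funext y
      rw [← Real.rpow_mul (h0 y), hαm]
    rw [e]
    -- The exponent $\alpha+1\ge 1$ permits the chain rule also at zeros of $h$.
    refine (((hs.differentiable (by simp)) x).hasDerivAt.rpow_const
      (Or.inr (by linarith : 1 ≤ α + 1))).congr_deriv ?_
    rw [add_sub_cancel_right]
    ring

end Stationary

end

theorem theorem1p3 :
    (∃ W ρ : UnitAddCircle → ℝ, SmoothOnTorus W ∧ SmoothOnTorus ρ ∧
      (∀ x : ℝ, ρ (x : UnitAddCircle) = Real.sin (2 * Real.pi * x) + 1) ∧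
      (∀ x, 0 ≤ ρ x) ∧ {x | ρ x = 0}.Nonempty ∧
      IsStationaryOnTorus 2 (fun _ => 0) W ρ) ∧
    (∀ m : ℝ, 1 < m → ∀ I : Set ℝ, IsOpen I →
      ∃ (ρ₀ V : ℝ → ℝ),
        (∀ x, 0 ≤ ρ₀ x) ∧ (∃ C, ∀ x, ρ₀ x ≤ C) ∧ Integrable ρ₀ ∧
        positivitySet ρ₀ = I ∧ SmoothBounded V ∧
        ∃ ρ : ℝ → ℝ → ℝ,
          (∀ T : ℝ, 0 < T → IsWeakSolution m T (fun _ x => V x) (fun _ _ => 0) ρ₀ ρ) ∧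
          (∀ T : ℝ, 0 < T → ∀ ρ' : ℝ → ℝ → ℝ,
            IsWeakSolution m T (fun _ x => V x) (fun _ _ => 0) ρ₀ ρ' →
              ∀ t ∈ Set.Icc 0 T, ρ' t =ᵐ[volume] ρ t) ∧
          ContinuousOn (Function.uncurry ρ) (Set.Ioi 0 ×ˢ Set.univ) ∧
          ∀ t : ℝ, 0 < t → freeBoundary (ρ t) = freeBoundary ρ₀) := by
  refine ⟨exists_stationary_on_torus, fun m hm I hI => ?_⟩
  obtain ⟨ρ₀, V, hc, h0, ⟨C, hC⟩, hi, hpos, hV, hflux⟩ := exists_stationary_profile hm hI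
  obtain ⟨A, hA⟩ := hV.2 0
  obtain ⟨B, hB⟩ := hV.2 1
  simp only [iteratedDeriv_zero] at hA
  simp only [iteratedDeriv_one] at hB
  have hsol : ∀ T : ℝ, 0 < T →
      IsWeakSolution m T (fun _ x => V x) (fun _ _ => 0) ρ₀ (fun _ => ρ₀) := fun T hT =>
    isWeakSolution_of_flux_eq_zero (by linarith) hT hc h0 hC hi hV.1.continuous hA hflux
  exact ⟨ρ₀, V, h0, ⟨C, hC⟩, hi, hpos, hV, fun _ => ρ₀, hsol,
    fun T hT ρ' hρ' => hρ'.unique hm hT hV.1 hA hB (hsol T hT),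
    (hc.comp continuous_snd).continuousOn, fun t _ => rfl⟩
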